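/- **Setting.** Let $1\le q\le m\le m'$, $k\ge 1$, and let $\mathcal P$ be a probability distribution with finite support on $\mathbb R^{m\times m'}$ (the original samples $\bar x$). For each sample $X$ let $\hat X_q=U_qS_qV_q^\top$ be a truncated SVD of $X$ with parameter $q$ (any fixed choice if it is not unique), and let $\mathcal P_q$ be the law of $\hat X_q$ for $X\sim\mathcal P$. Let $p(\cdot\mid\bar x)$ be the (discrete) distribution of the augmented sample of $\bar x$, let $x\mapsto y_x\in\{1,\dots,K\}$ be the deterministic ground-truth label, and let $$\alpha_q=\Pr_{\bar x\sim\mathcal P_q,\;x\sim p(\cdot\mid\bar x)}[y_x\ne y_{\bar x}]$$ be the labeling error after truncation. Let $\mathcal D_{aug}$ be the set of all samples that are generated with positive probability as $x\sim p(\cdot\mid\bar x)$, $\bar x\sim\mathcal P_q$; assume that it is finite, with $n$ elements, and that $k<n$. The augmentation graph has adjacency matrix $A_q(x,x')=\mathbb E_{\bar x\sim\mathcal P_q}[p(x\mid\bar x)p(x'\mid\bar x)]$ for $x,x'\in\mathcal D_{aug}$, diagonal degree matrix $D_q$ (the row sums of $A_q$) and normalized Laplacian $L_q=I-D_q^{-1/2}A_qD_q^{-1/2}$,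 whose eigenvalues with multiplicity are $\lambda_{1,q}\le\dots\le\lambda_{n,q}$. Let $f^*$ minimize, over all maps $f$ from samples to $\mathbb R^k$, the spectral contrastive loss $$\mathcal L_{spe}(f)=-2\,\mathbb E_{x,x^+}[f(x)^\top f(x^+)]+\mathbb E_{x,x^-}[(f(x)^\top f(x^-))^2],$$ where $x,x^+$ are two independent augmentations of the same $\bar x\sim\mathcal P_q$ and $x,x^-$ are augmentations of two independent samples from $\mathcal P_q$. Suppose that the augmented samples $x\sim p(\cdot\mid\bar x)$, $\bar x\sim\mathcal P_q$, follow the population distribution $\nu$ on which the downstream task is evaluated, where $\nu=\mathcal P$ or $\nu=\mathcal P_q$. For a linear head $W\in\mathbb R^{k\times K}$ let $g_{f,W}(x)\in\arg\max_{i}(f(x)^\top W)_i$ and $\mathcal E(f,W)=\Pr_{x\sim\nu}[g_{f,W}(x)\ne y_x]$. **Theorem (bound of classification error).** There is a linear head $W^*\in\mathbb R^{k\times K}$ with Frobenius norm $$\|W^*\|_F\le\frac1{1-\lambda_{k,q}}$$ such that, whatever rule breaks ties in the $\arg\max$, $$\mathcal E(f^*,W^*)\le\frac{4\alpha_q}{\lambda_{k+1,q}}+8\alpha_q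 .$$ Here the first bound is void if $\lambda_{k,q}=1$, and the second is void if $\lambda_{k+1,q}=0$. -/

import Mathlib

attribute [local instance] Matrix.frobeniusNormedAddCommGroup

/-- `X = U S Vᵀ` is a singular value decomposition of the `m × m'` matrix `X`, `m ≤ m'`: `U` and `V`
are orthogonal, and `S = [diag (s₁, …, s_m), 0]` with `s₁ ≥ … ≥ s_m ≥ 0`. -/
structure IsSVD {m m' : ℕ} (X : Matrix (Fin m) (Fin m') ℝ) (U : Matrix (Fin m) (Fin m) ℝ)
    (s : Fin m → ℝ) (V : Matrix (Fin m') (Fin m') ℝ) : Prop where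
  left_orthogonal : U ∈ Matrix.orthogonalGroup (Fin m) ℝ
  right_orthogonal : V ∈ Matrix.orthogonalGroup (Fin m') ℝ
  nonneg : ∀ i, 0 ≤ s i
  antitone : Antitone s
  eq_mul : X =
    U * (Matrix.of fun (i : Fin m) (j : Fin m') => if (i : ℕ) = (j : ℕ) then s i else 0) * V.transpose

/-- `Y` is a truncated SVD `U_q S_q V_qᵀ` of `X` with parameter `q`, where `U_q`, `V_q` consist of
the first `q` columns of `U`, `V` and `S_q = diag (s₁, …, s_q)`, for some SVD of `X`
(the decomposition need not be unique). -/
def IsTruncatedSVD {m m' q : ℕ} (hm : m ≤ m') (hq : q ≤ m)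
    (X Y : Matrix (Fin m) (Fin m') ℝ) : Prop :=
  ∃ (U : Matrix (Fin m) (Fin m) ℝ) (s : Fin m → ℝ) (V : Matrix (Fin m') (Fin m') ℝ),
    IsSVD X U s V ∧
      Y = U.submatrix id (Fin.castLE hq) * Matrix.diagonal (fun i => s (Fin.castLE hq i)) *
        (V.submatrix id (Fin.castLE (hq.trans hm))).transpose

namespace Contrastive

variable {X : Type*}

/-- Expectation of a real function under a discrete distribution. -/
noncomputable def expect (Q : PMF X) (φ : X → ℝ) : ℝ := ∑' x, (Q x).toReal * φ x

open Classical in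
/-- Labeling error `E_{x̄ ∼ Q, x ∼ p(·|x̄)} 𝟙[y_x ≠ y_x̄]`. -/
noncomputable def labelingError {K : ℕ} (Q : PMF X) (p : X → PMF X) (y : X → Fin K) : ℝ :=
  expect Q fun x₀ => expect (p x₀) fun x => if y x ≠ y x₀ then 1 else 0

/-- Marginal law of an augmented sample `x ∼ p(·|x̄)`, `x̄ ∼ Q`. -/
noncomputable def augLaw (Q : PMF X) (p : X → PMF X) : PMF X := Q.bind p

/-- The spectral contrastive loss
`-2 E_{x,x⁺} [f(x)ᵀ f(x⁺)] + E_{x,x⁻} [(f(x)ᵀ f(x⁻))²]`: `x, x⁺` are two independent augmentations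
of one original sample `x̄ ∼ Q`, and `x, x⁻` are augmentations of independent original samples. -/
noncomputable def spectralLoss {k : ℕ} (Q : PMF X) (p : X → PMF X)
    (f : X → EuclideanSpace ℝ (Fin k)) : ℝ :=
  -2 * expect Q (fun x₀ => expect (p x₀) fun x => expect (p x₀) fun x' => inner ℝ (f x) (f x')) +
    expect (augLaw Q p) fun x => expect (augLaw Q p) fun x' => (inner ℝ (f x) (f x')) ^ 2

/-- The augmentation dataset: all samples that can be generated from an original sample. -/
def augDataset (Q : PMF X) (p : X → PMF X) : Set X :=
  {x | ∃ x₀ ∈ Q.support, x ∈ (p x₀).support}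

/-- Adjacency matrix of the augmentation graph, `A(x,x') = E_{x̄ ∼ Q} [p(x|x̄) p(x'|x̄)]`. -/
noncomputable def adjacency (Q : PMF X) (p : X → PMF X) :
    Matrix (augDataset Q p) (augDataset Q p) ℝ :=
  Matrix.of fun x x' => expect Q fun x₀ => (p x₀ x).toReal * (p x₀ x').toReal

/-- Degree `D_{x,x} = ∑_{x'} A(x,x')`. -/
noncomputable def degree (Q : PMF X) (p : X → PMF X) [Fintype (augDataset Q p)]
    (x : augDataset Q p) : ℝ :=
  ∑ x', adjacency Q p x x'

open Classical in
/-- Normalized Laplacian `L = I - D^{-1/2} A D^{-1/2}`. -/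
noncomputable def laplacian (Q : PMF X) (p : X → PMF X) [Fintype (augDataset Q p)] :
    Matrix (augDataset Q p) (augDataset Q p) ℝ :=
  1 - Matrix.diagonal (fun x => (√(degree Q p x))⁻¹) * adjacency Q p *
    Matrix.diagonal (fun x => (√(degree Q p x))⁻¹)

theorem laplacian_isHermitian (Q : PMF X) (p : X → PMF X) [Fintype (augDataset Q p)] :
    (laplacian Q p).IsHermitian := by
  classical
  ext x x'
  simp [laplacian, adjacency, Matrix.diagonal_mul, Matrix.mul_diagonal, Matrix.one_apply, eq_comm,
    mul_comm, mul_left_comm]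

open Classical in
/-- Eigenvalues of the normalized Laplacian in increasing order, with multiplicity; the index counts
from `0`, so that `lapEigenvalue Q p ⟨i, _⟩` is `λ_{i+1}`. -/
noncomputable def lapEigenvalue (Q : PMF X) (p : X → PMF X) [Fintype (augDataset Q p)]
    (i : Fin (Fintype.card (augDataset Q p))) : ℝ :=
  (laplacian_isHermitian Q p).eigenvalues₀ i.rev

/-- `g = g_{f,W}`, that is, `g(x) ∈ argmax_i (f(x)ᵀ W)_i` (with some rule for breaking ties). -/
def IsLinearClassifier {k K : ℕ} (f : X → EuclideanSpace ℝ (Fin k))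
    (W : Matrix (Fin k) (Fin K) ℝ) (g : X → Fin K) : Prop :=
  ∀ x i, Matrix.vecMul (f x) W i ≤ Matrix.vecMul (f x) W (g x)

open Classical in
/-- Downstream classification error `Pr_{x ∼ ν} [g(x) ≠ y_x]`. -/
noncomputable def classError {K : ℕ} (ν : PMF X) (g y : X → Fin K) : ℝ :=
  expect ν fun x => if g x ≠ y x then 1 else 0

end Contrastive

/-!
With `F` the matrix with rows `√D_x f(x)` and `M = D^{-1/2} A D^{-1/2}`, the spectral contrastive loss
equals `‖M - F Fᵀ‖²` up to a constant (`Contrastive.spectralLoss_eq_factorLoss`), so an optimal encoder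
is a best factorization of `M` of rank at most `k`. Its spectral properties are extracted without the
Eckart-Young theorem. Fix a unit vector `w` and put `a = F w`. As a function of the component `h` of
`F` along `w`, the loss is `‖h‖⁴ - 2 ⟨h, B h⟩` up to a constant, where `B = M - F Fᵀ + a aᵀ`, and it is
minimal at `h = a`. Hence `⟨h, B h⟩ ≤ ‖a‖² ‖h‖²` for all `h`, with equality at `h = a`. Equality gives
`M F w = F Fᵀ F w`, so the range of `F` is invariant under `M`. The inequality, combined with dimension
counts against an eigenbasis of `M` with eigenvalues `γ₁ ≥ γ₂ ≥ …`, `γᵢ = 1 - λᵢ`, gives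

* `γ_k ‖w‖² ≤ ‖F w‖²` for all `w` (`Contrastive.eigenvalue_mul_le_of_optimal`);
* `⟨h, M h⟩ ≤ γ_{k+1} ‖h‖²` for `h` orthogonal to the range of `F`
  (`Contrastive.form_le_eigenvalue_of_optimal`).

The head `W` consists of least squares solutions of `F W_i ≈ u_i`, where `u_i(x) = √D_x 𝟙[y_x = i]`. As
`∑ ‖u_i‖² = 1`, the first bullet yields `γ_k ‖W‖² ≤ 1`. The Laplacian energy `∑ ⟨u_i, L u_i⟩` is the
probability that two augmentations of one sample have different labels, hence at most `2 α`; by the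
second bullet, `∑ ‖u_i - F W_i‖² ≤ 2 α / λ_{k+1}`. Finally, a misclassified sample has scores at squared
distance at least `1/2` from the one-hot vector of its label
(`Contrastive.classError_le_sum_residual`), so that the error is at most `4 α / λ_{k+1}`.
-/

/-! ### Optimal low-rank factorizations of a symmetric matrix -/

namespace Contrastive

open Matrix

variable {ι : Type*} [Fintype ι]

theorem dotProduct_self_nonneg (z : ι → ℝ) : 0 ≤ z ⬝ᵥ z := by
  simpa using dotProduct_star_self_nonneg z

theorem exists_eq_smul_unit {w : ι → ℝ} (hw : w ≠ 0) :
    ∃ (r : ℝ) (w' : ι → ℝ), w' ⬝ᵥ w' = 1 ∧ w = r • w' := by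
  have hpos : 0 < w ⬝ᵥ w := (dotProduct_self_nonneg w).lt_of_ne' (by simpa using hw)
  refine ⟨√(w ⬝ᵥ w), (√(w ⬝ᵥ w))⁻¹ • w, ?_, ?_⟩
  · simp only [smul_dotProduct, dotProduct_smul, smul_eq_mul]
    rw [← mul_assoc, ← mul_inv, Real.mul_self_sqrt hpos.le, inv_mul_cancel₀ hpos.ne']
  · rw [smul_smul, mul_inv_cancel₀ (Real.sqrt_pos.2 hpos).ne', one_smul]

/-- A minimizer `a` of `h ↦ ‖h‖⁴ - 2 ⟨h, B h⟩` has Rayleigh quotient `‖a‖²`, and `‖a‖²` dominates the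
quadratic form of `B`. Both follow by comparing `a` with the best multiples of `a` and of `h`. -/
theorem quartic_minimizer (B : Matrix ι ι ℝ) (a : ι → ℝ)
    (hmin : ∀ h : ι → ℝ, (a ⬝ᵥ a) ^ 2 - 2 * (a ⬝ᵥ B *ᵥ a) ≤ (h ⬝ᵥ h) ^ 2 - 2 * (h ⬝ᵥ B *ᵥ h)) :
    a ⬝ᵥ B *ᵥ a = (a ⬝ᵥ a) ^ 2 ∧ ∀ h : ι → ℝ, h ⬝ᵥ B *ᵥ h ≤ (a ⬝ᵥ a) * (h ⬝ᵥ h) := by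
  have hnn : ∀ h : ι → ℝ, 0 ≤ h ⬝ᵥ h := fun h => dotProduct_self_nonneg h
  have hscale : ∀ (h : ι → ℝ) (t : ℝ), 0 ≤ t →
      (a ⬝ᵥ a) ^ 2 - 2 * (a ⬝ᵥ B *ᵥ a) ≤ t ^ 2 * (h ⬝ᵥ h) ^ 2 - 2 * (t * (h ⬝ᵥ B *ᵥ h)) := by
    intro h t ht
    have h1 := hmin (√t • h)
    simp only [smul_dotProduct, dotProduct_smul, mulVec_smul, smul_eq_mul] at h1
    simp only [← mul_assoc, Real.mul_self_sqrt ht] at h1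
    nlinarith [h1]
  -- The optimal multiple of `h` has squared factor `⟨h, B h⟩ / ‖h‖⁴`.
  have hbest : ∀ h : ι → ℝ, 0 < h ⬝ᵥ h → 0 ≤ h ⬝ᵥ B *ᵥ h →
      (a ⬝ᵥ a) ^ 2 - 2 * (a ⬝ᵥ B *ᵥ a) ≤ - ((h ⬝ᵥ B *ᵥ h) / (h ⬝ᵥ h)) ^ 2 := by
    intro h h0 hB
    refine (hscale h ((h ⬝ᵥ B *ᵥ h) / (h ⬝ᵥ h) ^ 2) (by positivity)).trans_eq ?_
    field_simp
    ring
  have hzero := hscale a 0 le_rfl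
  have heq : a ⬝ᵥ B *ᵥ a = (a ⬝ᵥ a) ^ 2 := by
    rcases (hnn a).eq_or_lt with h0 | h0
    · have : a = 0 := dotProduct_self_eq_zero.1 h0.symm
      simp [this]
    · have h1 := hbest a h0 (by nlinarith [sq_nonneg (a ⬝ᵥ a)])
      have h2 : (a ⬝ᵥ a - (a ⬝ᵥ B *ᵥ a) / (a ⬝ᵥ a)) ^ 2 ≤ 0 := by
        have h3 : (a ⬝ᵥ a) * ((a ⬝ᵥ B *ᵥ a) / (a ⬝ᵥ a)) = a ⬝ᵥ B *ᵥ a := by field_simp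
        nlinarith
      have h4 : a ⬝ᵥ a - (a ⬝ᵥ B *ᵥ a) / (a ⬝ᵥ a) = 0 := pow_eq_zero_iff two_ne_zero |>.1
        (le_antisymm h2 (sq_nonneg _))
      field_simp at h4
      linarith
  refine ⟨heq, fun h => ?_⟩
  rcases le_or_gt (h ⬝ᵥ B *ᵥ h) 0 with hB | hB
  · exact hB.trans (mul_nonneg (hnn a) (hnn h))
  rcases (hnn h).eq_or_lt with h0 | h0
  · have : h = 0 := dotProduct_self_eq_zero.1 h0.symm
    simp [this]
  have h1 := hbest h h0 hB.le
  rw [heq] at h1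
  have h2 : (h ⬝ᵥ B *ᵥ h) / (h ⬝ᵥ h) ≤ a ⬝ᵥ a :=
    (abs_le_of_sq_le_sq' (by linarith) (hnn a)).2
  rwa [div_le_iff₀ h0] at h2

/-- The squared Frobenius distance from `F Fᵀ` to `M`, up to the constant `‖M‖²`. -/
def factorLoss {κ : Type*} [Fintype κ] (M : Matrix ι ι ℝ) (F : Matrix ι κ ℝ) : ℝ :=
  -2 * ∑ x, ∑ x', M x x' * (F * Fᵀ) x x' + ∑ x, ∑ x', (F * Fᵀ) x x' ^ 2

section Optimal

variable {κ : Type*} [Fintype κ] {M : Matrix ι ι ℝ} {F : Matrix ι κ ℝ}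

/-- The loss splits once the component of `F` along a unit vector `w` is replaced by `h`. -/
theorem factorLoss_update (M : Matrix ι ι ℝ) (F : Matrix ι κ ℝ) {w : κ → ℝ} (hw : w ⬝ᵥ w = 1)
    (h : ι → ℝ) :
    factorLoss M (F + vecMulVec (h - F *ᵥ w) w) =
      factorLoss M (F - vecMulVec (F *ᵥ w) w) + ((h ⬝ᵥ h) ^ 2 -
        2 * (h ⬝ᵥ (M - F * Fᵀ + vecMulVec (F *ᵥ w) (F *ᵥ w)) *ᵥ h)) := by
  have key : ∀ (h : ι → ℝ) (x x' : ι),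
      ((F + vecMulVec (h - F *ᵥ w) w) * (F + vecMulVec (h - F *ᵥ w) w)ᵀ) x x' =
        (F * Fᵀ) x x' - (F *ᵥ w) x * (F *ᵥ w) x' + h x * h x' := by
    intro h x x'
    have e1 : ∀ x, ∑ j, F x j * w j = (F *ᵥ w) x := fun x => rfl
    have e2 : ∑ j, w j * w j = 1 := hw
    have e3 : ∀ c d : ℝ, ∑ j, (F x j + c * w j) * (F x' j + d * w j) =
        ∑ j, F x j * F x' j + d * ∑ j, F x j * w j + c * ∑ j, F x' j * w j
          + c * d * ∑ j, w j * w j := by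
      intro c d
      simp only [Finset.mul_sum, ← Finset.sum_add_distrib]
      exact Finset.sum_congr rfl fun j _ => by ring
    simp only [mul_apply, transpose_apply, Matrix.add_apply, vecMulVec_apply, Pi.sub_apply, e3, e1, e2]
    ring
  have hz : F - vecMulVec (F *ᵥ w) w = F + vecMulVec ((0 : ι → ℝ) - F *ᵥ w) w := by
    ext; simp [vecMulVec_apply, sub_eq_add_neg]
  have hq : ∀ (N : Matrix ι ι ℝ), h ⬝ᵥ N *ᵥ h = ∑ x, ∑ x', N x x' * (h x * h x') := by
    intro N
    simp only [dotProduct, mulVec, Finset.mul_sum]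
    exact Finset.sum_congr rfl fun _ _ => Finset.sum_congr rfl fun _ _ => by ring
  have hs : (h ⬝ᵥ h) ^ 2 = ∑ x, ∑ x', (h x * h x') ^ 2 := by
    simp only [dotProduct, sq, Finset.sum_mul_sum]
    exact Finset.sum_congr rfl fun _ _ => Finset.sum_congr rfl fun _ _ => by ring
  rw [hz]
  simp only [factorLoss, key, hq, hs, Pi.zero_apply, mul_zero, add_zero, Matrix.add_apply, Matrix.sub_apply,
    vecMulVec_apply, Finset.mul_sum, ← Finset.sum_add_distrib, ← Finset.sum_sub_distrib]
  exact Finset.sum_congr rfl fun _ _ => Finset.sum_congr rfl fun _ _ => by ring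

theorem quartic_le_of_optimal (hF : ∀ G : Matrix ι κ ℝ, factorLoss M F ≤ factorLoss M G)
    {w : κ → ℝ} (hw : w ⬝ᵥ w = 1) (h : ι → ℝ) :
    ((F *ᵥ w) ⬝ᵥ (F *ᵥ w)) ^ 2 -
        2 * ((F *ᵥ w) ⬝ᵥ (M - F * Fᵀ + vecMulVec (F *ᵥ w) (F *ᵥ w)) *ᵥ (F *ᵥ w)) ≤
      (h ⬝ᵥ h) ^ 2 - 2 * (h ⬝ᵥ (M - F * Fᵀ + vecMulVec (F *ᵥ w) (F *ᵥ w)) *ᵥ h) := by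
  have h1 := hF (F + vecMulVec (h - F *ᵥ w) w)
  have h2 := factorLoss_update M F hw (F *ᵥ w)
  rw [sub_self, zero_vecMulVec, add_zero] at h2
  rw [factorLoss_update M F hw h, h2] at h1
  linarith

theorem dotProduct_residual_mulVec (M : Matrix ι ι ℝ) (F : Matrix ι κ ℝ) (a h : ι → ℝ) :
    h ⬝ᵥ (M - F * Fᵀ + vecMulVec a a) *ᵥ h =
      h ⬝ᵥ M *ᵥ h - (Fᵀ *ᵥ h) ⬝ᵥ (Fᵀ *ᵥ h) + (a ⬝ᵥ h) ^ 2 := by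
  have h1 : h ⬝ᵥ (F * Fᵀ) *ᵥ h = (Fᵀ *ᵥ h) ⬝ᵥ (Fᵀ *ᵥ h) := by
    rw [← mulVec_mulVec, dotProduct_mulVec, ← mulVec_transpose]
  rw [add_mulVec, sub_mulVec, dotProduct_add, dotProduct_sub, h1, vecMulVec_mulVec]
  simp only [dotProduct_smul, MulOpposite.smul_eq_mul_unop, MulOpposite.unop_op]
  rw [dotProduct_comm h a]
  ring

/-- Second-order optimality of a best factorization `F Fᵀ` of `M`. -/
theorem form_le_of_optimal (hF : ∀ G : Matrix ι κ ℝ, factorLoss M F ≤ factorLoss M G)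
    {w : κ → ℝ} (hw : w ⬝ᵥ w = 1) (h : ι → ℝ) :
    h ⬝ᵥ M *ᵥ h - (Fᵀ *ᵥ h) ⬝ᵥ (Fᵀ *ᵥ h) + ((F *ᵥ w) ⬝ᵥ h) ^ 2 ≤
      ((F *ᵥ w) ⬝ᵥ (F *ᵥ w)) * (h ⬝ᵥ h) := by
  rw [← dotProduct_residual_mulVec]
  exact (quartic_minimizer _ _ (quartic_le_of_optimal hF hw)).2 h

/-- First-order optimality of a best factorization `F Fᵀ` of `M`. The direction `F w` attains equality
in `form_le_of_optimal`, hence lies in the kernel of the positive semidefinite difference. -/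
theorem mulVec_eq_of_optimal (hM : Mᵀ = M)
    (hF : ∀ G : Matrix ι κ ℝ, factorLoss M F ≤ factorLoss M G) (w : κ → ℝ) :
    M *ᵥ (F *ᵥ w) = F *ᵥ (Fᵀ *ᵥ (F *ᵥ w)) := by
  classical
  have unit : ∀ w : κ → ℝ, w ⬝ᵥ w = 1 → M *ᵥ (F *ᵥ w) = F *ᵥ (Fᵀ *ᵥ (F *ᵥ w)) := by
    intro w hw
    set a := F *ᵥ w with ha
    obtain ⟨h1, h2⟩ := quartic_minimizer _ _ (quartic_le_of_optimal hF hw)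
    set B := M - F * Fᵀ + vecMulVec a a with hB
    have hBt : Bᵀ = B := by
      simp [hB, hM, transpose_vecMulVec]
    have hS : ((a ⬝ᵥ a) • (1 : Matrix ι ι ℝ) - B).PosSemidef := by
      refine PosSemidef.of_dotProduct_mulVec_nonneg ?_ fun h => ?_
      · rw [IsHermitian, conjTranspose_eq_transpose_of_trivial]
        simp [hBt]
      · have := h2 h
        simp only [star_trivial, sub_mulVec, smul_mulVec, one_mulVec, dotProduct_sub,
          dotProduct_smul, smul_eq_mul]
        linarith
    have h3 := (hS.dotProduct_mulVec_zero_iff a).1 (by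
      simp only [star_trivial, sub_mulVec, smul_mulVec, one_mulVec, dotProduct_sub,
          dotProduct_smul, smul_eq_mul]
      rw [h1]
      ring)
    have h4 : vecMulVec a a *ᵥ a = (a ⬝ᵥ a) • a := by
      rw [vecMulVec_mulVec]; ext; simp [mul_comm]
    rw [hB, sub_mulVec, smul_mulVec, one_mulVec, add_mulVec, h4, sub_mulVec, ← mulVec_mulVec] at h3
    have h5 : M *ᵥ a - F *ᵥ (Fᵀ *ᵥ a) = 0 := by
      rw [← neg_eq_zero, ← h3]; abel
    exact sub_eq_zero.1 h5
  by_cases h0 : w = 0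
  · simp [h0]
  obtain ⟨r, w', hw', rfl⟩ := exists_eq_smul_unit h0
  simp only [mulVec_smul, unit w' hw']

/-- The homogeneous form of `form_le_of_optimal` on vectors orthogonal to the range of `F`. -/
theorem form_mul_le_of_optimal (hF : ∀ G : Matrix ι κ ℝ, factorLoss M F ≤ factorLoss M G)
    {h : ι → ℝ} (hh : Fᵀ *ᵥ h = 0) (w : κ → ℝ) :
    (h ⬝ᵥ M *ᵥ h) * (w ⬝ᵥ w) ≤ ((F *ᵥ w) ⬝ᵥ (F *ᵥ w)) * (h ⬝ᵥ h) := by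
  by_cases h0 : w = 0
  · simp [h0]
  obtain ⟨r, w', hw', rfl⟩ := exists_eq_smul_unit h0
  have h1 := form_le_of_optimal hF hw' h
  have h2 : (F *ᵥ w') ⬝ᵥ h = 0 := by
    rw [dotProduct_comm, dotProduct_mulVec, ← mulVec_transpose, hh, zero_dotProduct]
  rw [h2, hh, dotProduct_zero] at h1
  simp only [mulVec_smul, smul_dotProduct, dotProduct_smul, smul_eq_mul, hw']
  nlinarith [mul_le_mul_of_nonneg_left h1 (sq_nonneg r)]

end Optimal

/-- `v` is an orthonormal eigenbasis of `M` with eigenvalues `γ` in decreasing order. This is encoded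
by the Parseval identity for `v` and its weighted form for the quadratic form of `M`. -/
structure DiagonalizedBy {n : ℕ} (M : Matrix ι ι ℝ) (v : Fin n → ι → ℝ) (γ : Fin n → ℝ) : Prop where
  card_eq : Fintype.card ι = n
  antitone : Antitone γ
  parseval : ∀ z, z ⬝ᵥ z = ∑ i, (v i ⬝ᵥ z) ^ 2
  form_eq : ∀ z, z ⬝ᵥ M *ᵥ z = ∑ i, γ i * (v i ⬝ᵥ z) ^ 2

section Spectral

variable {n k : ℕ} {M : Matrix ι ι ℝ} {F : Matrix ι (Fin k) ℝ} {v : Fin n → ι → ℝ} {γ : Fin n → ℝ}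

/-- The squared singular values of an optimal `F` with `k` columns are at least the `k`-th largest
eigenvalue of `M`: otherwise the component of `F` along `w` could be traded for a vector of the
leading eigenspace that is orthogonal to `F w'` for all `w' ⊥ w`. -/
theorem eigenvalue_mul_le_of_optimal (hd : DiagonalizedBy M v γ)
    (hF : ∀ G : Matrix ι (Fin k) ℝ, factorLoss M F ≤ factorLoss M G)
    (hk : 1 ≤ k) (hkn : k - 1 < n) (w : Fin k → ℝ) :
    γ ⟨k - 1, hkn⟩ * (w ⬝ᵥ w) ≤ (F *ᵥ w) ⬝ᵥ (F *ᵥ w) := by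
  have unit : ∀ w : Fin k → ℝ, w ⬝ᵥ w = 1 → γ ⟨k - 1, hkn⟩ ≤ (F *ᵥ w) ⬝ᵥ (F *ᵥ w) := by
    intro w hw
    let T : (ι → ℝ) →ₗ[ℝ] (Fin n → ℝ) :=
      { toFun := fun z i => if h : (i : ℕ) < k then
          (Fᵀ *ᵥ z) ⟨i, h⟩ - (w ⬝ᵥ Fᵀ *ᵥ z) * w ⟨i, h⟩ else v i ⬝ᵥ z
        map_add' := by
          intro a b; ext i
          by_cases h : (i : ℕ) < k <;> simp [h, mulVec_add, dotProduct_add]; ring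
        map_smul' := by
          intro c a; ext i
          by_cases h : (i : ℕ) < k <;> simp [h, mulVec_smul, dotProduct_smul]; ring }
    -- `T` has range in a proper subspace: its first `k` coordinates form a vector orthogonal to `w`.
    have hT : ¬ Function.Injective T := by
      intro hinj
      have hsurj := (LinearMap.injective_iff_surjective_of_finrank_eq_finrank (f := T)
        (by simp [hd.card_eq])).1 hinj
      obtain ⟨z, hz⟩ := hsurj fun i => if h : (i : ℕ) < k then w ⟨i, h⟩ else 0
      have h1 : ∀ j : Fin k, (Fᵀ *ᵥ z) j - (w ⬝ᵥ Fᵀ *ᵥ z) * w j = w j := by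
        intro j
        have h2 := congrFun hz ⟨j, by have := j.2; omega⟩
        simpa [T] using h2
      have h2 : w ⬝ᵥ (Fᵀ *ᵥ z - (w ⬝ᵥ Fᵀ *ᵥ z) • w) = w ⬝ᵥ w := by
        congr 1; ext j; simpa using h1 j
      rw [dotProduct_sub, dotProduct_smul, hw] at h2
      simp at h2
    obtain ⟨z, hz, hz0⟩ : ∃ z, T z = 0 ∧ z ≠ 0 := by
      by_contra! hcon
      exact hT ((injective_iff_map_eq_zero T).2 hcon)
    have hz1 : Fᵀ *ᵥ z = (w ⬝ᵥ Fᵀ *ᵥ z) • w := by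
      ext j
      have h2 := congrFun hz ⟨j, by have := j.2; omega⟩
      have h3 : (Fᵀ *ᵥ z) j - (w ⬝ᵥ Fᵀ *ᵥ z) * w j = 0 := by simpa [T] using h2
      simpa using sub_eq_zero.1 h3
    have hz2 : ∀ i : Fin n, k ≤ i → v i ⬝ᵥ z = 0 := by
      intro i hi
      simpa [T, not_lt.2 hi] using congrFun hz i
    have hpos : 0 < z ⬝ᵥ z := (dotProduct_self_nonneg z).lt_of_ne' (by simpa using hz0)
    have h1 := form_le_of_optimal hF hw z
    have h2 : (F *ᵥ w) ⬝ᵥ z = w ⬝ᵥ Fᵀ *ᵥ z := by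
      rw [dotProduct_comm, dotProduct_mulVec, ← mulVec_transpose, dotProduct_comm]
    have h3 : (Fᵀ *ᵥ z) ⬝ᵥ (Fᵀ *ᵥ z) = (w ⬝ᵥ Fᵀ *ᵥ z) ^ 2 := by
      conv_lhs => rw [hz1]
      simp [smul_dotProduct, dotProduct_smul, hw, sq]
    rw [h2, h3, sub_add_cancel, hd.form_eq] at h1
    have h4 : γ ⟨k - 1, hkn⟩ * (z ⬝ᵥ z) ≤ ∑ i, γ i * (v i ⬝ᵥ z) ^ 2 := by
      rw [hd.parseval, Finset.mul_sum]
      refine Finset.sum_le_sum fun i _ => ?_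
      by_cases hi : k ≤ i
      · simp [hz2 i hi]
      · exact mul_le_mul_of_nonneg_right (hd.antitone (Fin.le_def.2 (by simp; omega))) (sq_nonneg _)
    exact le_of_mul_le_mul_right (h4.trans h1) hpos
  by_cases h0 : w = 0
  · simp [h0]
  obtain ⟨r, w', hw', rfl⟩ := exists_eq_smul_unit h0
  simp only [mulVec_smul, smul_dotProduct, dotProduct_smul, smul_eq_mul, hw']
  nlinarith [mul_le_mul_of_nonneg_left (unit w' hw') (sq_nonneg r)]

/-- On the orthogonal complement of the range of an optimal `F` with `k` columns, the form of `M` is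
bounded by its `(k+1)`-st largest eigenvalue. If some `h` in the complement violated this, then the
form would exceed that eigenvalue on the `(k+1)`-dimensional span of the range of `F` and `h`, which
meets the complement of the `k` leading eigenvectors. -/
theorem form_le_eigenvalue_of_optimal (hd : DiagonalizedBy M v γ) (hM : Mᵀ = M)
    (hF : ∀ G : Matrix ι (Fin k) ℝ, factorLoss M F ≤ factorLoss M G)
    (hkn : k < n) (hγ : 0 ≤ γ ⟨k, hkn⟩) {h : ι → ℝ} (hh : Fᵀ *ᵥ h = 0) :
    h ⬝ᵥ M *ᵥ h ≤ γ ⟨k, hkn⟩ * (h ⬝ᵥ h) := by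
  by_contra! hlt
  set c := h ⬝ᵥ M *ᵥ h with hc
  have hh0 : 0 ≤ h ⬝ᵥ h := dotProduct_self_nonneg h
  have hcpos : 0 < c := (mul_nonneg hγ hh0).trans_lt hlt
  have hpos : 0 < h ⬝ᵥ h := by
    refine hh0.lt_of_ne' fun h0 => ?_
    have : h = 0 := dotProduct_self_eq_zero.1 h0
    simp [hc, this] at hcpos
  have hw := form_mul_le_of_optimal hF hh
  rw [← hc] at hw
  have horth : ∀ w, h ⬝ᵥ F *ᵥ w = 0 := by
    intro w
    rw [dotProduct_mulVec, ← mulVec_transpose, hh, zero_dotProduct]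
  let T : ((Fin k → ℝ) × ℝ) →ₗ[ℝ] (Fin k → ℝ) :=
    { toFun := fun a i => v ⟨i, i.2.trans hkn⟩ ⬝ᵥ (F *ᵥ a.1 + a.2 • h)
      map_add' := by
        intro a b; ext i
        simp [mulVec_add, dotProduct_add, add_mul]; ring
      map_smul' := by
        intro r a; ext i
        simp [mulVec_smul, dotProduct_smul, dotProduct_add]; ring }
  obtain ⟨⟨w, t⟩, hT, hne⟩ := (Submodule.ne_bot_iff _).1
    (LinearMap.ker_ne_bot_of_finrank_lt (f := T) (by simp))
  set z := F *ᵥ w + t • h with hz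
  have hvz : ∀ i : Fin n, (i : ℕ) < k → v i ⬝ᵥ z = 0 := fun i hi =>
    congrFun (LinearMap.mem_ker.1 hT) ⟨i, hi⟩
  have hzz : z ⬝ᵥ z = (F *ᵥ w) ⬝ᵥ (F *ᵥ w) + t ^ 2 * (h ⬝ᵥ h) := by
    simp only [hz, add_dotProduct, dotProduct_add, smul_dotProduct, dotProduct_smul, horth,
      dotProduct_comm _ h, smul_eq_mul]
    ring
  have hF2 : (F *ᵥ w) ⬝ᵥ M *ᵥ (F *ᵥ w) = (Fᵀ *ᵥ (F *ᵥ w)) ⬝ᵥ (Fᵀ *ᵥ (F *ᵥ w)) := by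
    rw [mulVec_eq_of_optimal hM hF, dotProduct_mulVec, ← mulVec_transpose]
  have hcross : h ⬝ᵥ M *ᵥ (F *ᵥ w) = 0 := by
    rw [mulVec_eq_of_optimal hM hF, horth]
  have hcross' : (F *ᵥ w) ⬝ᵥ M *ᵥ h = 0 := by
    rw [dotProduct_mulVec, ← mulVec_transpose, hM, dotProduct_comm, hcross]
  have hzM : z ⬝ᵥ M *ᵥ z = (Fᵀ *ᵥ (F *ᵥ w)) ⬝ᵥ (Fᵀ *ᵥ (F *ᵥ w)) + t ^ 2 * c := by
    simp only [hz, mulVec_add, mulVec_smul, add_dotProduct, dotProduct_add, smul_dotProduct,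
      dotProduct_smul, hcross, hcross', hF2, smul_eq_mul, ← hc]
    ring
  have hle : z ⬝ᵥ M *ᵥ z ≤ γ ⟨k, hkn⟩ * (z ⬝ᵥ z) := by
    rw [hd.form_eq, hd.parseval, Finset.mul_sum]
    refine Finset.sum_le_sum fun i _ => ?_
    by_cases hi : (i : ℕ) < k
    · simp [hvz i hi]
    · exact mul_le_mul_of_nonneg_right (hd.antitone (Fin.le_def.2 (by simpa using hi)))
        (sq_nonneg _)
  rw [hzM, hzz] at hle
  have hcs : ((F *ᵥ w) ⬝ᵥ (F *ᵥ w)) ^ 2 ≤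
      (w ⬝ᵥ w) * ((Fᵀ *ᵥ (F *ᵥ w)) ⬝ᵥ (Fᵀ *ᵥ (F *ᵥ w))) := by
    have h1 : (F *ᵥ w) ⬝ᵥ (F *ᵥ w) = w ⬝ᵥ Fᵀ *ᵥ (F *ᵥ w) := by
      rw [dotProduct_mulVec (F *ᵥ w), ← mulVec_transpose, dotProduct_comm]
    rw [h1]
    have := Finset.sum_mul_sq_le_sq_mul_sq Finset.univ w (Fᵀ *ᵥ (F *ᵥ w))
    simpa [dotProduct, sq] using this
  have hw1 := hw w
  set s := (F *ᵥ w) ⬝ᵥ (F *ᵥ w)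
  set r := (Fᵀ *ᵥ (F *ᵥ w)) ⬝ᵥ (Fᵀ *ᵥ (F *ᵥ w))
  have hs0 : 0 ≤ s := dotProduct_self_nonneg _
  have hr0 : 0 ≤ r := dotProduct_self_nonneg _
  have hww0 : 0 ≤ w ⬝ᵥ w := dotProduct_self_nonneg _
  rcases hs0.eq_or_lt with hs | hs
  · -- `F w = 0` forces `w = 0`, and then `t ≠ 0` gives the contradiction.
    rw [← hs] at hle hw1
    have hw0 : w = 0 := by
      refine dotProduct_self_eq_zero.1 (le_antisymm ?_ hww0)
      by_contra! hcon
      nlinarith [mul_pos hcpos hcon]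
    have ht : t ≠ 0 := by
      rintro rfl
      exact hne (by simp [hw0])
    have ht2 : 0 < t ^ 2 := by positivity
    nlinarith [mul_pos ht2 (sub_pos.2 hlt)]
  · have h1 : c * s ≤ r * (h ⬝ᵥ h) := by
      have : s * (c * s) ≤ s * (r * (h ⬝ᵥ h)) := by
        nlinarith [mul_le_mul_of_nonneg_left hcs hcpos.le, mul_le_mul_of_nonneg_left hw1 hr0]
      exact le_of_mul_le_mul_left this hs
    have h2 : γ ⟨k, hkn⟩ * s * (h ⬝ᵥ h) < c * s := by nlinarith [mul_pos hs (sub_pos.2 hlt)]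
    have h3 : γ ⟨k, hkn⟩ * s < r := by
      refine lt_of_mul_lt_mul_right (h2.trans_le h1) hh0
    nlinarith [mul_nonneg (sq_nonneg t) (sub_pos.2 hlt).le]

end Spectral

/-- Existence of a least squares solution, in the form of the normal equations. -/
theorem exists_normal_equations {κ : Type*} [Fintype κ] (F : Matrix ι κ ℝ) (u : ι → ℝ) :
    ∃ w : κ → ℝ, Fᵀ *ᵥ (u - F *ᵥ w) = 0 := by
  classical
  have hle : LinearMap.range (Fᵀ * F).mulVecLin ≤ LinearMap.range Fᵀ.mulVecLin := by
    rw [mulVecLin_mul]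
    exact LinearMap.range_comp_le_range _ _
  have heq := Submodule.eq_of_le_of_finrank_eq hle (by
    have h1 : (Fᵀ * F).rank = Fᵀ.rank := by rw [rank_transpose_mul_self, rank_transpose]
    exact h1)
  have hmem : Fᵀ *ᵥ u ∈ LinearMap.range (Fᵀ * F).mulVecLin := by
    rw [heq]; exact ⟨u, rfl⟩
  obtain ⟨w, hw⟩ := hmem
  refine ⟨w, ?_⟩
  rw [mulVec_sub, mulVec_mulVec, ← hw, mulVecLin_apply, sub_self]

end Contrastive

/-! ### The augmentation graph and its normalized Laplacian -/

namespace Contrastive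

open Matrix

section Augmentation

variable {X : Type*} {Q : PMF X} {p : X → PMF X}

theorem expect_eq_sum (hQ : Q.support.Finite) (φ : X → ℝ) :
    expect Q φ = ∑ x ∈ hQ.toFinset, (Q x).toReal * φ x := by
  refine tsum_eq_sum fun x hx => ?_
  have : Q x = 0 := by simpa using hx
  simp [this]

theorem support_kernel_subset {x₀ : X} (h : x₀ ∈ Q.support) : (p x₀).support ⊆ augDataset Q p :=
  fun _ hx => ⟨x₀, h, hx⟩

theorem support_augLaw : (augLaw Q p).support = augDataset Q p := by
  ext x
  simp [augLaw, augDataset]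

theorem augLaw_toReal (hQ : Q.support.Finite) (x : X) :
    (augLaw Q p x).toReal = ∑ x₀ ∈ hQ.toFinset, (Q x₀).toReal * (p x₀ x).toReal := by
  rw [← expect_eq_sum hQ fun x₀ => (p x₀ x).toReal, augLaw, PMF.bind_apply, ENNReal.tsum_toReal_eq]
  · simp [expect]
  · exact fun x₀ => ENNReal.mul_ne_top (Q.apply_ne_top _) ((p x₀).apply_ne_top _)

theorem adjacency_apply (hQ : Q.support.Finite) (x x' : augDataset Q p) :
    adjacency Q p x x' =
      ∑ x₀ ∈ hQ.toFinset, (Q x₀).toReal * ((p x₀ x).toReal * (p x₀ x').toReal) :=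
  expect_eq_sum hQ _

theorem adjacency_comm (x x' : augDataset Q p) : adjacency Q p x x' = adjacency Q p x' x := by
  simp [adjacency, mul_comm]

theorem adjacency_nonneg (hQ : Q.support.Finite) (x x' : augDataset Q p) :
    0 ≤ adjacency Q p x x' := by
  rw [adjacency_apply hQ]
  positivity

variable [Fintype (augDataset Q p)]

theorem expect_eq_sum_augDataset (R : PMF X) (hR : R.support ⊆ augDataset Q p) (φ : X → ℝ) :
    expect R φ = ∑ x : augDataset Q p, (R x).toReal * φ x := by
  rw [expect, ← tsum_fintype (L := .unconditional _),
    tsum_subtype (augDataset Q p) (fun x => (R x).toReal * φ x)]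
  congr 1
  ext x
  by_cases hx : x ∈ augDataset Q p
  · simp [hx]
  · have : R x = 0 := by
      by_contra h
      exact hx (hR (R.mem_support_iff x |>.2 h))
    simp [Set.indicator_of_notMem hx, this]

theorem sum_toReal_augDataset (R : PMF X) (hR : R.support ⊆ augDataset Q p) :
    ∑ x : augDataset Q p, (R x).toReal = 1 := by
  have h1 := expect_eq_sum_augDataset R hR fun _ => 1
  simp only [expect, mul_one] at h1
  rw [← h1, ← ENNReal.tsum_toReal_eq fun x => R.apply_ne_top x, R.tsum_coe, ENNReal.toReal_one]

/-- Averaging over two independent augmentations of one sample is integration against the adjacency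
matrix. -/
theorem expect_pair (hQ : Q.support.Finite) (φ : X → X → ℝ) :
    expect Q (fun x₀ => expect (p x₀) fun x => expect (p x₀) fun x' => φ x x') =
      ∑ x : augDataset Q p, ∑ x' : augDataset Q p, adjacency Q p x x' * φ x x' := by
  simp only [adjacency_apply hQ, Finset.sum_mul]
  simp only [Finset.sum_comm (t := hQ.toFinset)]
  rw [expect_eq_sum hQ]
  refine Finset.sum_congr rfl fun x₀ h₀ => ?_
  have hs := support_kernel_subset (p := p) (hQ.mem_toFinset.1 h₀)
  simp only [expect_eq_sum_augDataset (p x₀) hs, Finset.mul_sum]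
  exact Finset.sum_congr rfl fun _ _ => Finset.sum_congr rfl fun _ _ => by ring

theorem degree_eq (hQ : Q.support.Finite) (x : augDataset Q p) :
    degree Q p x = (augLaw Q p x).toReal := by
  simp only [degree, adjacency_apply hQ]
  rw [Finset.sum_comm, augLaw_toReal hQ]
  refine Finset.sum_congr rfl fun x₀ h₀ => ?_
  rw [← Finset.mul_sum, ← Finset.mul_sum,
    sum_toReal_augDataset _ (support_kernel_subset (hQ.mem_toFinset.1 h₀)), mul_one]

theorem degree_pos (hQ : Q.support.Finite) (x : augDataset Q p) : 0 < degree Q p x := by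
  rw [degree_eq hQ]
  refine ENNReal.toReal_pos ?_ ((augLaw Q p).apply_ne_top _)
  rw [← PMF.mem_support_iff, support_augLaw]
  exact x.2

theorem sum_degree (hQ : Q.support.Finite) : ∑ x, degree Q p x = 1 := by
  simp only [degree_eq hQ]
  exact sum_toReal_augDataset _ support_augLaw.le

theorem expect_augLaw (hQ : Q.support.Finite) (φ : X → ℝ) :
    expect (augLaw Q p) φ = ∑ x : augDataset Q p, degree Q p x * φ x := by
  simp only [degree_eq hQ]
  exact expect_eq_sum_augDataset _ support_augLaw.le φ

variable (Q p) in
/-- The normalized adjacency matrix `D^{-1/2} A D^{-1/2}`. -/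
noncomputable def normalizedAdjacency : Matrix (augDataset Q p) (augDataset Q p) ℝ :=
  Matrix.of fun x x' => (√(degree Q p x))⁻¹ * adjacency Q p x x' * (√(degree Q p x'))⁻¹

open Classical in
theorem laplacian_eq : laplacian Q p = 1 - normalizedAdjacency Q p := by
  rw [laplacian]
  congr 1
  ext x x'
  simp [normalizedAdjacency, Matrix.diagonal_mul, Matrix.mul_diagonal]

theorem normalizedAdjacency_transpose : (normalizedAdjacency Q p)ᵀ = normalizedAdjacency Q p := by
  ext x x'
  simp only [normalizedAdjacency, transpose_apply, of_apply, adjacency_comm x' x]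
  ring

theorem normalizedAdjacency_form (hQ : Q.support.Finite) (c : augDataset Q p → ℝ) :
    (fun x => √(degree Q p x) * c x) ⬝ᵥ
        normalizedAdjacency Q p *ᵥ (fun x => √(degree Q p x) * c x) =
      ∑ x, ∑ x', adjacency Q p x x' * (c x * c x') := by
  simp only [dotProduct, mulVec, Finset.mul_sum, normalizedAdjacency, of_apply]
  refine Finset.sum_congr rfl fun x _ => Finset.sum_congr rfl fun x' _ => ?_
  have h1 := (Real.sqrt_pos.2 (degree_pos hQ x)).ne'
  have h2 := (Real.sqrt_pos.2 (degree_pos hQ x')).ne'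
  field_simp

theorem eq_sqrt_degree_mul (hQ : Q.support.Finite) (z : augDataset Q p → ℝ) :
    z = fun x => √(degree Q p x) * (z x / √(degree Q p x)) := by
  ext x
  have h1 := (Real.sqrt_pos.2 (degree_pos hQ x)).ne'
  field_simp

theorem sqrt_degree_dotProduct (hQ : Q.support.Finite) (c : augDataset Q p → ℝ) :
    (fun x => √(degree Q p x) * c x) ⬝ᵥ (fun x => √(degree Q p x) * c x) =
      ∑ x, degree Q p x * c x ^ 2 := by
  refine Finset.sum_congr rfl fun x _ => ?_
  rw [mul_mul_mul_comm, Real.mul_self_sqrt (degree_pos hQ x).le, sq]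

/-- The quadratic form of the normalized Laplacian is the Dirichlet form of the augmentation
graph. -/
theorem dirichlet_form (hQ : Q.support.Finite) (c : augDataset Q p → ℝ) :
    (fun x => √(degree Q p x) * c x) ⬝ᵥ (fun x => √(degree Q p x) * c x) -
      (fun x => √(degree Q p x) * c x) ⬝ᵥ
        normalizedAdjacency Q p *ᵥ (fun x => √(degree Q p x) * c x) =
      1 / 2 * ∑ x, ∑ x', adjacency Q p x x' * (c x - c x') ^ 2 := by
  rw [normalizedAdjacency_form hQ, sqrt_degree_dotProduct hQ]
  have h1 : ∑ x, degree Q p x * c x ^ 2 = ∑ x, ∑ x', adjacency Q p x x' * c x ^ 2 := by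
    simp only [degree, Finset.sum_mul]
  have h2 : ∑ x, degree Q p x * c x ^ 2 = ∑ x, ∑ x', adjacency Q p x x' * c x' ^ 2 := by
    rw [h1, Finset.sum_comm]
    exact Finset.sum_congr rfl fun x _ => Finset.sum_congr rfl fun x' _ => by
      rw [adjacency_comm]
  have h3 : ∑ x, ∑ x', adjacency Q p x x' * (c x - c x') ^ 2 =
      ∑ x, ∑ x', adjacency Q p x x' * c x ^ 2 + ∑ x, ∑ x', adjacency Q p x x' * c x' ^ 2
        - 2 * ∑ x, ∑ x', adjacency Q p x x' * (c x * c x') := by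
    simp only [Finset.mul_sum, ← Finset.sum_add_distrib, ← Finset.sum_sub_distrib]
    exact Finset.sum_congr rfl fun x _ => Finset.sum_congr rfl fun x' _ => by ring
  rw [h3, ← h1, ← h2]
  ring

theorem form_normalizedAdjacency_le (hQ : Q.support.Finite) (z : augDataset Q p → ℝ) :
    z ⬝ᵥ normalizedAdjacency Q p *ᵥ z ≤ z ⬝ᵥ z := by
  have h1 := dirichlet_form hQ fun x => z x / √(degree Q p x)
  rw [← eq_sqrt_degree_mul hQ z] at h1
  have h2 : 0 ≤ ∑ x, ∑ x', adjacency Q p x x' *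
      (z x / √(degree Q p x) - z x' / √(degree Q p x')) ^ 2 :=
    Finset.sum_nonneg fun x _ => Finset.sum_nonneg fun x' _ =>
      mul_nonneg (adjacency_nonneg hQ x x') (sq_nonneg _)
  linarith

theorem form_normalizedAdjacency_nonneg (hQ : Q.support.Finite) (z : augDataset Q p → ℝ) :
    0 ≤ z ⬝ᵥ normalizedAdjacency Q p *ᵥ z := by
  rw [eq_sqrt_degree_mul hQ z, normalizedAdjacency_form hQ]
  simp only [adjacency_apply hQ, Finset.sum_mul]
  set c : augDataset Q p → ℝ := fun x => z x / √(degree Q p x)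
  have h1 : ∑ x : augDataset Q p, ∑ x' : augDataset Q p, ∑ x₀ ∈ hQ.toFinset,
      (Q x₀).toReal * ((p x₀ x).toReal * (p x₀ x').toReal) * (c x * c x') =
      ∑ x₀ ∈ hQ.toFinset, (Q x₀).toReal * (∑ x : augDataset Q p, (p x₀ x).toReal * c x) ^ 2 := by
    have h2 : ∀ x₀, (∑ x : augDataset Q p, (p x₀ x).toReal * c x) ^ 2 =
        ∑ x : augDataset Q p, ∑ x' : augDataset Q p,
          ((p x₀ x).toReal * c x) * ((p x₀ x').toReal * c x') := fun x₀ => by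
      rw [sq, Finset.sum_mul_sum]
    simp only [h2, Finset.mul_sum]
    rw [Finset.sum_comm (s := hQ.toFinset)]
    refine Finset.sum_congr rfl fun x _ => ?_
    rw [Finset.sum_comm]
    exact Finset.sum_congr rfl fun x₀ _ => Finset.sum_congr rfl fun x' _ => by ring
  rw [h1]
  positivity

variable (Q p) in
/-- The matrix with rows `√D_x f(x)`, for `x` in the augmentation dataset. -/
noncomputable def featureMatrix {k : ℕ} (f : X → EuclideanSpace ℝ (Fin k)) :
    Matrix (augDataset Q p) (Fin k) ℝ :=
  Matrix.of fun x j => √(degree Q p x) * f x j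

theorem featureMatrix_mul_transpose {k : ℕ} (f : X → EuclideanSpace ℝ (Fin k))
    (x x' : augDataset Q p) :
    (featureMatrix Q p f * (featureMatrix Q p f)ᵀ) x x' =
      √(degree Q p x) * √(degree Q p x') * inner ℝ (f x) (f x') := by
  simp only [mul_apply, featureMatrix, transpose_apply, of_apply, PiLp.inner_apply, Finset.mul_sum]
  refine Finset.sum_congr rfl fun j _ => ?_
  simp
  ring

/-- The spectral contrastive loss is a matrix factorization loss. -/
theorem spectralLoss_eq_factorLoss (hQ : Q.support.Finite) {k : ℕ}
    (f : X → EuclideanSpace ℝ (Fin k)) :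
    spectralLoss Q p f = factorLoss (normalizedAdjacency Q p) (featureMatrix Q p f) := by
  rw [spectralLoss, factorLoss, expect_pair hQ fun x x' => inner ℝ (f x) (f x')]
  congr 2
  · refine Finset.sum_congr rfl fun x _ => Finset.sum_congr rfl fun x' _ => ?_
    rw [featureMatrix_mul_transpose, normalizedAdjacency, of_apply]
    have h1 := (Real.sqrt_pos.2 (degree_pos hQ x)).ne'
    have h2 := (Real.sqrt_pos.2 (degree_pos hQ x')).ne'
    field_simp
  · simp only [expect_augLaw hQ, Finset.mul_sum]
    refine Finset.sum_congr rfl fun x _ => Finset.sum_congr rfl fun x' _ => ?_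
    rw [featureMatrix_mul_transpose, mul_pow, mul_pow, Real.sq_sqrt (degree_pos hQ x).le,
      Real.sq_sqrt (degree_pos hQ x').le]
    ring

theorem exists_featureMatrix_eq (hQ : Q.support.Finite) {k : ℕ}
    (G : Matrix (augDataset Q p) (Fin k) ℝ) :
    ∃ f : X → EuclideanSpace ℝ (Fin k), featureMatrix Q p f = G := by
  classical
  refine ⟨fun x => if h : x ∈ augDataset Q p then
    WithLp.toLp 2 fun j => G ⟨x, h⟩ j / √(degree Q p ⟨x, h⟩) else 0, ?_⟩
  ext x j
  have h1 := (Real.sqrt_pos.2 (degree_pos hQ x)).ne'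
  simp only [featureMatrix, of_apply, Subtype.coe_prop, dite_true]
  field_simp

theorem factorLoss_featureMatrix_le (hQ : Q.support.Finite) {k : ℕ}
    {f : X → EuclideanSpace ℝ (Fin k)}
    (hf : ∀ h : X → EuclideanSpace ℝ (Fin k), spectralLoss Q p f ≤ spectralLoss Q p h)
    (G : Matrix (augDataset Q p) (Fin k) ℝ) :
    factorLoss (normalizedAdjacency Q p) (featureMatrix Q p f) ≤
      factorLoss (normalizedAdjacency Q p) G := by
  obtain ⟨h, rfl⟩ := exists_featureMatrix_eq hQ G
  rw [← spectralLoss_eq_factorLoss hQ, ← spectralLoss_eq_factorLoss hQ]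
  exact hf h

open Classical in
variable (Q p) in
/-- Eigenvectors of the normalized Laplacian, ordered as `lapEigenvalue`. -/
noncomputable def lapEigenvector (i : Fin (Fintype.card (augDataset Q p))) :
    EuclideanSpace ℝ (augDataset Q p) :=
  (laplacian_isHermitian Q p).eigenvectorBasis
    (Fintype.equivOfCardEq (Fintype.card_fin _) i.rev)

theorem normalizedAdjacency_mulVec_lapEigenvector (i : Fin (Fintype.card (augDataset Q p))) :
    normalizedAdjacency Q p *ᵥ (lapEigenvector Q p i).ofLp =
      (1 - lapEigenvalue Q p i) • (lapEigenvector Q p i).ofLp := by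
  classical
  have h1 := (laplacian_isHermitian Q p).mulVec_eigenvectorBasis
    (Fintype.equivOfCardEq (Fintype.card_fin _) i.rev)
  rw [IsHermitian.eigenvalues, Equiv.symm_apply_apply] at h1
  have h2 : laplacian Q p *ᵥ (lapEigenvector Q p i).ofLp =
      lapEigenvalue Q p i • (lapEigenvector Q p i).ofLp := by
    exact h1
  rw [laplacian_eq, sub_mulVec, one_mulVec] at h2
  rw [sub_smul, one_smul, ← h2, sub_sub_cancel]

theorem sum_lapEigenvector_mul (z z' : augDataset Q p → ℝ) :
    ∑ i, ((lapEigenvector Q p i).ofLp ⬝ᵥ z) * ((lapEigenvector Q p i).ofLp ⬝ᵥ z') = z ⬝ᵥ z' := by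
  classical
  have h1 := ((laplacian_isHermitian Q p).eigenvectorBasis.reindex
    (Fin.revPerm.trans (Fintype.equivOfCardEq (Fintype.card_fin _))).symm).sum_inner_mul_inner
    (WithLp.toLp 2 z) (WithLp.toLp 2 z')
  have h2 : ∀ a b : EuclideanSpace ℝ (augDataset Q p), inner ℝ a b = a.ofLp ⬝ᵥ b.ofLp := by
    intro a b
    simp [PiLp.inner_apply, dotProduct, mul_comm]
  simp only [h2, OrthonormalBasis.reindex_apply, Equiv.symm_symm] at h1
  rw [← h1]
  refine Finset.sum_congr rfl fun i _ => ?_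
  congr 1
  rw [dotProduct_comm]
  rfl

open Classical in
theorem diagonalizedBy_lapEigenvector :
    DiagonalizedBy (normalizedAdjacency Q p) (fun i => (lapEigenvector Q p i).ofLp)
      (fun i => 1 - lapEigenvalue Q p i) where
  card_eq := rfl
  antitone := fun i j hij => by
    have := (laplacian_isHermitian Q p).eigenvalues₀_antitone (Fin.rev_le_rev.2 hij)
    simp only [lapEigenvalue]
    linarith
  parseval := fun z => by
    rw [← sum_lapEigenvector_mul z z]
    simp only [sq]
  form_eq := fun z => by
    rw [← sum_lapEigenvector_mul z]
    refine Finset.sum_congr rfl fun i _ => ?_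
    rw [dotProduct_mulVec, ← mulVec_transpose, normalizedAdjacency_transpose,
      normalizedAdjacency_mulVec_lapEigenvector, smul_dotProduct, smul_eq_mul]
    ring

open Classical in
theorem lapEigenvector_dotProduct_self (i : Fin (Fintype.card (augDataset Q p))) :
    (lapEigenvector Q p i).ofLp ⬝ᵥ (lapEigenvector Q p i).ofLp = 1 := by
  have h1 : ‖lapEigenvector Q p i‖ = 1 := by
    exact OrthonormalBasis.norm_eq_one (laplacian_isHermitian Q p).eigenvectorBasis _
  have h2 := EuclideanSpace.real_norm_sq_eq (lapEigenvector Q p i)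
  rw [h1] at h2
  simpa [dotProduct, sq] using h2.symm

theorem lapEigenvalue_mem_Icc (hQ : Q.support.Finite)
    (i : Fin (Fintype.card (augDataset Q p))) : lapEigenvalue Q p i ∈ Set.Icc (0 : ℝ) 1 := by
  have h1 := form_normalizedAdjacency_nonneg hQ (lapEigenvector Q p i).ofLp
  have h2 := form_normalizedAdjacency_le hQ (lapEigenvector Q p i).ofLp
  rw [normalizedAdjacency_mulVec_lapEigenvector, dotProduct_smul, lapEigenvector_dotProduct_self,
    smul_eq_mul, mul_one] at h1 h2
  constructor <;> linarith

end Augmentation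

end Contrastive

/-! ### Linear heads and classification error -/

namespace Contrastive

open Matrix

section Classification

variable {X : Type*} {Q : PMF X} {p : X → PMF X}

theorem labelingError_nonneg {K : ℕ} (hQ : Q.support.Finite) (y : X → Fin K) :
    0 ≤ labelingError Q p y := by
  classical
  rw [labelingError, expect_eq_sum hQ]
  refine Finset.sum_nonneg fun x₀ _ => mul_nonneg ENNReal.toReal_nonneg (tsum_nonneg fun x => ?_)
  dsimp only
  split_ifs <;> positivity

variable [Fintype (augDataset Q p)]

open Classical in
/-- Two augmentations of one sample have different labels with probability at most twice the labeling
error, since one of them must disagree with the sample. -/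
theorem sum_adjacency_ne_le {K : ℕ} (hQ : Q.support.Finite) (y : X → Fin K) :
    ∑ x, ∑ x', adjacency Q p x x' * (if y x ≠ y x' then 1 else 0) ≤
      2 * labelingError Q p y := by
  set e : X → X → ℝ := fun x₀ x => if y x ≠ y x₀ then 1 else 0 with he
  have hα : labelingError Q p y =
      ∑ x₀ ∈ hQ.toFinset, ∑ x : augDataset Q p, (Q x₀).toReal * ((p x₀ x).toReal * e x₀ x) := by
    rw [labelingError, expect_eq_sum hQ]
    refine Finset.sum_congr rfl fun x₀ h₀ => ?_
    rw [expect_eq_sum_augDataset (p x₀) (support_kernel_subset (hQ.mem_toFinset.1 h₀)),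
      Finset.mul_sum]
  have hpair : ∑ x, ∑ x', adjacency Q p x x' * (if y x ≠ y x' then (1 : ℝ) else 0) =
      ∑ x₀ ∈ hQ.toFinset, ∑ x : augDataset Q p, ∑ x' : augDataset Q p,
        (Q x₀).toReal * ((p x₀ x).toReal * (p x₀ x').toReal) *
          (if y x ≠ y x' then (1 : ℝ) else 0) := by
    simp only [adjacency_apply hQ, Finset.sum_mul]
    rw [Finset.sum_comm (s := hQ.toFinset)]
    exact Finset.sum_congr rfl fun x _ => Finset.sum_comm
  rw [hpair, hα, Finset.mul_sum]
  refine Finset.sum_le_sum fun x₀ h₀ => ?_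
  have h1 : ∑ x : augDataset Q p, (p x₀ x).toReal = 1 :=
    sum_toReal_augDataset _ (support_kernel_subset (hQ.mem_toFinset.1 h₀))
  set π : augDataset Q p → ℝ := fun x => (p x₀ x).toReal
  have hle : ∀ x x' : augDataset Q p,
      (Q x₀).toReal * (π x * π x') * (if y x ≠ y x' then (1 : ℝ) else 0) ≤
        (Q x₀).toReal * (π x * π x') * (e x₀ x + e x₀ x') := by
    intro x x'
    refine mul_le_mul_of_nonneg_left ?_ (by positivity)
    simp only [he]
    by_cases h : y x = y x₀ <;> by_cases h' : y x' = y x₀ <;> by_cases h'' : y x = y x' <;>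
      simp_all
  calc ∑ x, ∑ x', (Q x₀).toReal * (π x * π x') * (if y x ≠ y x' then (1 : ℝ) else 0)
      ≤ ∑ x, ∑ x', (Q x₀).toReal * (π x * π x') * (e x₀ x + e x₀ x') :=
        Finset.sum_le_sum fun x _ => Finset.sum_le_sum fun x' _ => hle x x'
    _ = (Q x₀).toReal * ((∑ x, π x * e x₀ x) * (∑ x', π x')) +
          (Q x₀).toReal * ((∑ x, π x) * (∑ x', π x' * e x₀ x')) := by
        rw [Finset.sum_mul_sum, Finset.sum_mul_sum]
        simp only [Finset.mul_sum, ← Finset.sum_add_distrib]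
        exact Finset.sum_congr rfl fun x _ => Finset.sum_congr rfl fun x' _ => by ring
    _ = 2 * ∑ x, (Q x₀).toReal * (π x * e x₀ x) := by
        rw [h1, ← Finset.mul_sum]
        ring

variable (Q p) in
open Classical in
/-- The vector with entries `√D_x 𝟙[y_x = i]` of the `i`-th label, in the scaling of the normalized Laplacian. -/
noncomputable def labelVector {K : ℕ} (y : X → Fin K) (i : Fin K) (x : augDataset Q p) : ℝ :=
  √(degree Q p x) * (if y x = i then 1 else 0)

theorem sum_labelVector_dotProduct_self {K : ℕ} (hQ : Q.support.Finite) (y : X → Fin K) :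
    ∑ i, labelVector Q p y i ⬝ᵥ labelVector Q p y i = 1 := by
  classical
  rw [← sum_degree (Q := Q) (p := p) hQ]
  have h1 : ∀ i, labelVector Q p y i ⬝ᵥ labelVector Q p y i =
      ∑ x, degree Q p x * (if y x = i then (1 : ℝ) else 0) ^ 2 := fun i =>
    sqrt_degree_dotProduct hQ fun x : augDataset Q p => if y x = i then 1 else 0
  simp only [h1]
  rw [Finset.sum_comm]
  simp

theorem sum_labelVector_laplacian_le {K : ℕ} (hQ : Q.support.Finite) (y : X → Fin K) :
    ∑ i, (labelVector Q p y i ⬝ᵥ labelVector Q p y i -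
      labelVector Q p y i ⬝ᵥ normalizedAdjacency Q p *ᵥ labelVector Q p y i) ≤
      2 * labelingError Q p y := by
  classical
  refine le_of_eq_of_le ?_ (sum_adjacency_ne_le hQ y)
  have h1 : ∀ i, labelVector Q p y i ⬝ᵥ labelVector Q p y i -
      labelVector Q p y i ⬝ᵥ normalizedAdjacency Q p *ᵥ labelVector Q p y i =
      1 / 2 * ∑ x : augDataset Q p, ∑ x' : augDataset Q p, adjacency Q p x x' *
        ((if y x = i then (1 : ℝ) else 0) - (if y x' = i then (1 : ℝ) else 0)) ^ 2 := fun i =>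
    dirichlet_form hQ fun x : augDataset Q p => if y x = i then 1 else 0
  simp only [h1]
  rw [← Finset.mul_sum, Finset.sum_comm, Finset.mul_sum]
  refine Finset.sum_congr rfl fun x _ => ?_
  rw [Finset.sum_comm, Finset.mul_sum]
  refine Finset.sum_congr rfl fun x' _ => ?_
  rw [← Finset.mul_sum]
  -- Two distinct one-hot vectors are at squared distance `2`.
  have h2 : ∀ a b : Fin K, ∑ i, ((if a = i then (1 : ℝ) else 0) - (if b = i then 1 else 0)) ^ 2 =
      2 * if a ≠ b then 1 else 0 := by
    intro a b
    have h3 : ∀ i, ((if a = i then (1 : ℝ) else 0) - (if b = i then 1 else 0)) ^ 2 =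
        (if a = i then 1 else 0) + (if b = i then 1 else 0) -
          2 * (if a = i then (if b = i then 1 else 0) else 0) := by
      intro i
      split_ifs <;> norm_num
    simp only [h3, Finset.sum_sub_distrib, Finset.sum_add_distrib, ← Finset.mul_sum]
    by_cases h : a = b
    · simp [h]; norm_num
    · simp [h, Ne.symm h]; norm_num
  rw [h2]
  ring

/-- An arg max classifier that errs on `x` has scores at squared distance at least `1/2` from the one-hot
vector of the true label. -/
theorem half_le_sum_sq_sub_oneHot {K : ℕ} (s : Fin K → ℝ) {a b : Fin K} (hab : a ≠ b)
    (hs : s b ≤ s a) : 1 / 2 ≤ ∑ i, (s i - if b = i then 1 else 0) ^ 2 := by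
  have h1 : ∑ i ∈ {a, b}, (s i - if b = i then 1 else 0) ^ 2 ≤
      ∑ i, (s i - if b = i then 1 else 0) ^ 2 :=
    Finset.sum_le_sum_of_subset_of_nonneg (Finset.subset_univ _) fun _ _ _ => sq_nonneg _
  rw [Finset.sum_pair hab] at h1
  simp only [hab.symm, if_false, if_true] at h1
  nlinarith [sq_nonneg (s a + s b - 1), sq_nonneg (s a - 1 / 2), sq_nonneg (s a - s b + 1)]

/-- The classification error of a linear head is at most twice its squared loss on one-hot labels. -/
theorem classError_le_sum_residual {k K : ℕ} (hQ : Q.support.Finite) {y g : X → Fin K}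
    {f : X → EuclideanSpace ℝ (Fin k)} {W : Matrix (Fin k) (Fin K) ℝ}
    (hg : IsLinearClassifier f W g) :
    classError (augLaw Q p) g y ≤ 2 * ∑ i,
      (labelVector Q p y i - featureMatrix Q p f *ᵥ W.col i) ⬝ᵥ
        (labelVector Q p y i - featureMatrix Q p f *ᵥ W.col i) := by
  classical
  have hres : ∀ i, labelVector Q p y i - featureMatrix Q p f *ᵥ W.col i = fun x =>
      √(degree Q p x) * ((if y x = i then 1 else 0) - vecMul (f x) W i) := by
    intro i
    ext x
    simp only [labelVector, featureMatrix, Pi.sub_apply, mulVec, vecMul, dotProduct, of_apply,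
      mul_sub, Finset.mul_sum, col_apply, mul_assoc]
  simp only [hres, sqrt_degree_dotProduct hQ]
  rw [classError, expect_augLaw hQ, Finset.sum_comm, Finset.mul_sum]
  refine Finset.sum_le_sum fun x _ => ?_
  rw [← Finset.mul_sum, mul_left_comm]
  refine mul_le_mul_of_nonneg_left ?_ (degree_pos hQ x).le
  by_cases h : g x = y x
  · simp only [h, ne_eq, not_true_eq_false, if_false]
    exact mul_nonneg zero_le_two (Finset.sum_nonneg fun _ _ => sq_nonneg _)
  · have h1 := half_le_sum_sq_sub_oneHot (vecMul (f x) W) h (hg x (y x))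
    simp only [ne_eq, h, not_false_eq_true, if_true]
    simp only [sub_sq_comm (if _ then (1 : ℝ) else 0)]
    linarith

/-- Approximation of a vector `u` by the range of an optimal feature matrix `F`: the least squares
residual is orthogonal to the range, which is invariant under the Laplacian, so it carries at most
the Laplacian energy of `u`. -/
theorem lapEigenvalue_mul_residual_le {k : ℕ} (hQ : Q.support.Finite)
    {F : Matrix (augDataset Q p) (Fin k) ℝ}
    (hF : ∀ G : Matrix (augDataset Q p) (Fin k) ℝ, factorLoss (normalizedAdjacency Q p) F ≤
      factorLoss (normalizedAdjacency Q p) G)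
    (hkn : k < Fintype.card (augDataset Q p)) {u : augDataset Q p → ℝ} {w : Fin k → ℝ}
    (hw : Fᵀ *ᵥ (u - F *ᵥ w) = 0) :
    lapEigenvalue Q p ⟨k, hkn⟩ * ((u - F *ᵥ w) ⬝ᵥ (u - F *ᵥ w)) ≤
      u ⬝ᵥ u - u ⬝ᵥ normalizedAdjacency Q p *ᵥ u := by
  set h := u - F *ᵥ w with hh
  have hu : u = F *ᵥ w + h := by rw [hh]; abel
  have horth : ∀ w', h ⬝ᵥ F *ᵥ w' = 0 := by
    intro w'
    rw [dotProduct_mulVec, ← mulVec_transpose, hw, zero_dotProduct]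
  have hcross : h ⬝ᵥ normalizedAdjacency Q p *ᵥ (F *ᵥ w) = 0 := by
    rw [mulVec_eq_of_optimal normalizedAdjacency_transpose hF, horth]
  have hcross' : (F *ᵥ w) ⬝ᵥ normalizedAdjacency Q p *ᵥ h = 0 := by
    rw [dotProduct_mulVec, ← mulVec_transpose, normalizedAdjacency_transpose, dotProduct_comm,
      hcross]
  have h1 := form_le_eigenvalue_of_optimal diagonalizedBy_lapEigenvector
    normalizedAdjacency_transpose hF hkn (sub_nonneg.2 (lapEigenvalue_mem_Icc hQ _).2) hw
  have h2 := form_normalizedAdjacency_le hQ (F *ᵥ w)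
  rw [hu]
  simp only [mulVec_add, add_dotProduct, dotProduct_add, hcross, hcross', horth,
    dotProduct_comm _ h]
  linarith

theorem dotProduct_self_le_of_residual {ι κ : Type*} [Fintype ι] [Fintype κ] {F : Matrix ι κ ℝ}
    {u : ι → ℝ} {w : κ → ℝ} (hw : Fᵀ *ᵥ (u - F *ᵥ w) = 0) :
    (F *ᵥ w) ⬝ᵥ (F *ᵥ w) ≤ u ⬝ᵥ u := by
  have horth : (u - F *ᵥ w) ⬝ᵥ F *ᵥ w = 0 := by
    rw [dotProduct_mulVec, ← mulVec_transpose, hw, zero_dotProduct]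
  have h1 := dotProduct_self_nonneg (u - F *ᵥ w)
  rw [dotProduct_sub, horth, sub_dotProduct] at h1
  rw [sub_dotProduct, dotProduct_comm u] at horth
  rw [dotProduct_comm (F *ᵥ w) u] at h1
  rw [dotProduct_comm (F *ᵥ w) u] at horth
  linarith

theorem frobenius_norm_sq {k K : ℕ} (W : Matrix (Fin k) (Fin K) ℝ) :
    ‖W‖ ^ 2 = ∑ i, W.col i ⬝ᵥ W.col i := by
  rw [frobenius_norm_def, ← Real.sqrt_eq_rpow, Real.sq_sqrt (by positivity), Finset.sum_comm]
  simp [dotProduct, sq]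

/-- The least squares head on an optimal encoder, for any sample space. The error bound
has no additive term in `α`, because the one-hot vectors of the true labels, with no majority vote
over augmentations, are what the head approximates. -/
theorem exists_linear_head {k K : ℕ} (hQ : Q.support.Finite) (hk : 1 ≤ k)
    (hkn : k < Fintype.card (augDataset Q p)) (y : X → Fin K)
    (f : X → EuclideanSpace ℝ (Fin k))
    (hf : ∀ h : X → EuclideanSpace ℝ (Fin k), spectralLoss Q p f ≤ spectralLoss Q p h) :
    ∃ W : Matrix (Fin k) (Fin K) ℝ,
      (lapEigenvalue Q p ⟨k - 1, (Nat.sub_le k 1).trans_lt hkn⟩ < 1 →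
        ‖W‖ ≤ 1 / (1 - lapEigenvalue Q p ⟨k - 1, (Nat.sub_le k 1).trans_lt hkn⟩)) ∧
      (0 < lapEigenvalue Q p ⟨k, hkn⟩ → ∀ g : X → Fin K, IsLinearClassifier f W g →
        classError (augLaw Q p) g y ≤
          4 * labelingError Q p y / lapEigenvalue Q p ⟨k, hkn⟩) := by
  have hF := factorLoss_featureMatrix_le hQ hf
  choose w hw using fun i => exists_normal_equations (featureMatrix Q p f) (labelVector Q p y i)
  refine ⟨Matrix.of fun j i => w i j, fun hlt => ?_, fun hpos g hg => ?_⟩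
  · set γ := 1 - lapEigenvalue Q p ⟨k - 1, (Nat.sub_le k 1).trans_lt hkn⟩ with hγ
    have hγ0 : 0 < γ := sub_pos.2 hlt
    have hγ1 : γ ≤ 1 := by
      linarith [(lapEigenvalue_mem_Icc (p := p) hQ ⟨k - 1, (Nat.sub_le k 1).trans_lt hkn⟩).1]
    have h1 : γ * ‖Matrix.of fun j i => w i j‖ ^ 2 ≤ 1 := by
      rw [frobenius_norm_sq, Finset.mul_sum, ← sum_labelVector_dotProduct_self (p := p) hQ y]
      exact Finset.sum_le_sum fun i _ =>
        (eigenvalue_mul_le_of_optimal diagonalizedBy_lapEigenvector hF hk _ (w i)).trans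
          (dotProduct_self_le_of_residual (hw i))
    -- The argument gives `‖W‖² ≤ 1/γ`, and `1/γ ≤ 1/γ²` because `γ ≤ 1`.
    rw [le_div_iff₀ hγ0]
    have h2 : (‖Matrix.of fun j i => w i j‖ * γ) ^ 2 ≤ 1 ^ 2 := by
      nlinarith [mul_le_mul_of_nonneg_left h1 hγ0.le]
    exact (abs_le_of_sq_le_sq' h2 zero_le_one).2
  · refine (classError_le_sum_residual hQ hg).trans ?_
    rw [le_div_iff₀ hpos]
    have h1 : lapEigenvalue Q p ⟨k, hkn⟩ * ∑ i,
        (labelVector Q p y i - featureMatrix Q p f *ᵥ w i) ⬝ᵥ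
          (labelVector Q p y i - featureMatrix Q p f *ᵥ w i) ≤ 2 * labelingError Q p y := by
      rw [Finset.mul_sum]
      exact (Finset.sum_le_sum fun i _ => lapEigenvalue_mul_residual_le hQ hF hkn (hw i)).trans
        (sum_labelVector_laplacian_le hQ y)
    have h2 : ∀ i, (Matrix.of fun j i => w i j).col i = w i := fun i => rfl
    simp only [h2]
    linarith

end Classification

end Contrastive

theorem theorem3 {m m' q k K : ℕ} (hm : m ≤ m') (hq1 : 1 ≤ q) (hq : q ≤ m) (hk : 1 ≤ k)
    -- law of the original samples, with finite support, and the truncated SVD of each sample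
    (P : PMF (Matrix (Fin m) (Fin m') ℝ)) (hP : P.support.Finite)
    (svd : Matrix (Fin m) (Fin m') ℝ → Matrix (Fin m) (Fin m') ℝ)
    (hsvd : ∀ X, IsTruncatedSVD hm hq X (svd X))
    (Pq : PMF (Matrix (Fin m) (Fin m') ℝ)) (hPq : Pq = P.map svd)
    -- law of the augmented sample given the sample, and the ground-truth labels
    (p : Matrix (Fin m) (Fin m') ℝ → PMF (Matrix (Fin m) (Fin m') ℝ))
    (y : Matrix (Fin m) (Fin m') ℝ → Fin K)
    [Fintype (Contrastive.augDataset Pq p)]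
    (hkn : k < Fintype.card (Contrastive.augDataset Pq p))
    -- an optimal encoder
    (f : Matrix (Fin m) (Fin m') ℝ → EuclideanSpace ℝ (Fin k))
    (hf : ∀ h : Matrix (Fin m) (Fin m') ℝ → EuclideanSpace ℝ (Fin k),
      Contrastive.spectralLoss Pq p f ≤ Contrastive.spectralLoss Pq p h)
    -- the test population (before or after compression); augmented samples follow the same law
    (ν : PMF (Matrix (Fin m) (Fin m') ℝ)) (hν : ν = P ∨ ν = Pq)
    (hpop : Contrastive.augLaw Pq p = ν) :
    ∃ W : Matrix (Fin k) (Fin K) ℝ,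
      (Contrastive.lapEigenvalue Pq p ⟨k - 1, (Nat.sub_le k 1).trans_lt hkn⟩ < 1 →
        ‖W‖ ≤ 1 / (1 - Contrastive.lapEigenvalue Pq p ⟨k - 1, (Nat.sub_le k 1).trans_lt hkn⟩)) ∧
      (0 < Contrastive.lapEigenvalue Pq p ⟨k, hkn⟩ →
        ∀ g : Matrix (Fin m) (Fin m') ℝ → Fin K, Contrastive.IsLinearClassifier f W g →
          Contrastive.classError ν g y ≤
            4 * Contrastive.labelingError Pq p y / Contrastive.lapEigenvalue Pq p ⟨k, hkn⟩ +
              8 * Contrastive.labelingError Pq p y) := by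
  have hQ : Pq.support.Finite := by
    rw [hPq, PMF.support_map]
    exact hP.image svd
  obtain ⟨W, hW, herr⟩ := Contrastive.exists_linear_head hQ hk hkn y f hf
  refine ⟨W, hW, fun hpos g hg => ?_⟩
  have h1 := herr hpos g hg
  have h2 := Contrastive.labelingError_nonneg (p := p) hQ y
  rw [← hpop]
  linarith
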